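/- Let $n\ge 0$ be an integer and consider the $n\times n$ square region of the square lattice: $n^2$ vertices, the edges joining neighbouring vertices, and $4n$ external edges attached to the vertices on the sides (two at each corner). Order the external edges counter-clockwise, starting from the vertical external edge at the bottom-left corner. A fully-packed loop configuration (FPL) is a colouring of all these edges in black and white such that every vertex is adjacent to exactly two black and two white edges. Let $\mathrm{Fpl}(n,+)$ (respectively $\mathrm{Fpl}(n,-)$) be the set of FPLs whose external edges, in the above order, are coloured alternately black, white, black, white, $\dots$ (respectively white, black, white, black, $\dots$). Label the $2n$ black external edges by $1,\dots,2n$ in this order. The black open paths of an FPL $\phi$ pair these labels without crossings; this pairing is the link pattern $\pi(\phi)\in \mathrm{LP}(n)$, where $\mathrm{LP}(n)$ is the set of non-crossing perfect matchings of $2n$ cyclically ordered points. Let $R$ be the rotation of link patterns, which replaces every pair $(i,j)$ by $(i-1,j-1)$ modulo $2n$; write $[\pi]$ for the class of $\pi$ under the powers of $R$, and $\mathrm{Fpl}(n,\pm;[\pi])$ for the set of $\phi\in\mathrm{Fpl}(n,\pm)$ with $\pi(\phi)\in[\pi]$. A plaquette $\alpha$ is a unit square whose four corners are vertices of the region. Put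 $\mathcal N_\alpha(\phi)=+1$ if the two horizontal sides of $\alpha$ are black and the two vertical sides white in $\phi$, $\mathcal N_\alpha(\phi)=-1$ if the two horizontal sides are white and the two vertical sides black, and $\mathcal N_\alpha(\phi)=0$ otherwise. Then, for either choice of sign $\pm$, for every plaquette $\alpha$ and every rotation class $[\pi]$ of link patterns in $\mathrm{LP}(n)$, $$\sum_{\phi\in \mathrm{Fpl}(n,\pm;[\pi])}\mathcal N_\alpha(\phi)=0 .$$ Equivalently, in vector notation, $\mathrm{Sym}\,\Pi_\pm\,\widetilde{\mathcal N}_\alpha\,|s_{n,\pm}\rangle\!\rangle=0$ in $\mathbb C^{\mathrm{LP}(n)}$, where $|s_{n,\pm}\rangle\!\rangle=\sum_{\phi\in\mathrm{Fpl}(n,\pm)}|\phi\rangle\!\rangle\in\mathbb C^{\mathrm{Fpl}(n,\pm)}$, and $\widetilde{\mathcal N}_\alpha$, $\Pi_\pm$, $\mathrm{Sym}$ are the linear maps given by $\widetilde{\mathcal N}_\alpha|\phi\rangle\!\rangle=\mathcal N_\alpha(\phi)|\phi\rangle\!\rangle$, $\Pi_\pm|\phi\rangle\!\rangle=|\pi(\phi)\rangle$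 and $\mathrm{Sym}=\sum_{k=0}^{2n-1}R^k$ (with $R|\pi\rangle=|R\pi\rangle$). -/

import Mathlib

namespace FPL

/-! ### A fact about finite graphs -/

theorem degree_toSimpleGraph {V : Type} [Fintype V] (G : SimpleGraph V)
    (C : G.ConnectedComponent) [Fintype C] [DecidableRel G.Adj] [DecidableRel C.toSimpleGraph.Adj]
    (v : C) : C.toSimpleGraph.degree v = G.degree v := by
  classical
  rw [← SimpleGraph.card_neighborFinset_eq_degree, ← SimpleGraph.card_neighborFinset_eq_degree]
  refine Finset.card_bij (fun w _ => (w : V)) ?_ ?_ ?_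
  · intro w hw
    simp only [SimpleGraph.mem_neighborFinset] at hw ⊢
    exact hw
  · intro w _ w' _ h
    exact Subtype.ext h
  · intro w hw
    rw [SimpleGraph.mem_neighborFinset] at hw
    have hwC : w ∈ C := by
      have := v.2
      exact C.mem_supp_of_adj_mem_supp this hw
    refine ⟨⟨w, hwC⟩, ?_, rfl⟩
    rw [SimpleGraph.mem_neighborFinset]
    exact hw

/-- In a finite graph, if all degrees in the component of `a` are `1` or `2` and `a` has
degree `1`, then the component is a path: it has exactly one other vertex of degree `1`. -/
theorem existsUnique_other_end {V : Type} [Fintype V] (G : SimpleGraph V) [DecidableRel G.Adj]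
    (a : V) (hdeg : ∀ v, G.Reachable a v → G.degree v = 1 ∨ G.degree v = 2)
    (ha : G.degree a = 1) :
    ∃! b, b ≠ a ∧ G.Reachable a b ∧ G.degree b = 1 := by
  classical
  set C := G.connectedComponentMk a with hC
  have hmem : ∀ v, v ∈ C ↔ G.Reachable a v := by
    intro v
    rw [SimpleGraph.reachable_comm]
    exact SimpleGraph.ConnectedComponent.eq
  let aC : C := ⟨a, (hmem a).2 (SimpleGraph.Reachable.refl a)⟩
  have hd : ∀ v : C, C.toSimpleGraph.degree v = G.degree (v : V) :=
    fun v => degree_toSimpleGraph G C v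
  let S : Finset C := Finset.univ.filter fun v => G.degree (v : V) = 1
  have h1 : ∑ v : C, G.degree (v : V) = 2 * C.toSimpleGraph.edgeFinset.card := by
    rw [← SimpleGraph.sum_degrees_eq_twice_card_edges]
    exact Finset.sum_congr rfl fun v _ => (hd v).symm
  have h2 : ∑ v : C, G.degree (v : V) + S.card = 2 * Fintype.card C := by
    rw [Finset.card_filter, ← Finset.sum_add_distrib]
    have : ∀ v ∈ (Finset.univ : Finset C),
        G.degree (v : V) + (if G.degree (v : V) = 1 then 1 else 0) = 2 := by
      intro v _
      rcases hdeg v ((hmem v).1 v.2) with h | h <;> simp [h]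
    rw [Finset.sum_congr rfl this]
    simp [mul_comm]
  have h3 : Fintype.card C ≤ C.toSimpleGraph.edgeFinset.card + 1 := by
    have := C.connected_toSimpleGraph.card_vert_le_card_edgeSet_add_one
    rw [Nat.card_eq_fintype_card, Nat.card_eq_fintype_card] at this
    rwa [SimpleGraph.edgeFinset_card]
  have haS : aC ∈ S := by simp [S, aC, ha]
  have h4 : 0 < S.card := Finset.card_pos.2 ⟨_, haS⟩
  have h5 : (S.erase aC).card = 1 := by
    rw [Finset.card_erase_of_mem haS]; omega
  obtain ⟨b, hb⟩ := Finset.card_eq_one.1 h5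
  have hbS : b ∈ S.erase aC := by simp [hb]
  rw [Finset.mem_erase] at hbS
  refine ⟨b, ⟨fun h => hbS.1 (Subtype.ext h), (hmem b).1 b.2, ?_⟩, ?_⟩
  · simpa [S] using hbS.2
  · rintro c ⟨hca, hac, hc⟩
    have : (⟨c, (hmem c).2 hac⟩ : C) ∈ S.erase aC := by
      rw [Finset.mem_erase]
      refine ⟨fun h => hca (congrArg Subtype.val h), by simp [S, hc]⟩
    rw [hb, Finset.mem_singleton] at this
    exact congrArg Subtype.val this

/-! ### The square domain and its fully-packed loops -/

/-- Vertices of the `n × n` square: `(x, y)` is in column `x` (from the left) and row `y`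
(from the bottom). -/
abbrev Vertex (n : ℕ) : Type := Fin n × Fin n

/-- Edges of the `n × n` square, including the `4 n` external ones.
`inl (x, y)` is the horizontal edge of row `y` from `(x - 1, y)` to `(x, y)`, and
`inr (x, y)` is the vertical edge of column `x` from `(x, y - 1)` to `(x, y)`;
it is external when one of these two points is not a vertex of the square. -/
abbrev Edge (n : ℕ) : Type := (Fin (n + 1) × Fin n) ⊕ (Fin n × Fin (n + 1))

/-- The four edges (left, right, bottom, top) at a vertex. -/
def incident {n : ℕ} (v : Vertex n) : Finset (Edge n) :=
  {.inl (v.1.castSucc, v.2), .inl (v.1.succ, v.2), .inr (v.1, v.2.castSucc), .inr (v.1, v.2.succ)}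

/-- The external edges in counter-clockwise order, starting from the vertical one at the
bottom-left corner: bottom side, right side, top side, left side. -/
def leg {n : ℕ} (p : Fin (4 * n)) : Edge n :=
  if h₁ : p.1 < n then .inr (⟨p.1, h₁⟩, 0)
  else if h₂ : p.1 < 2 * n then .inl (Fin.last n, ⟨p.1 - n, by omega⟩)
  else if h₃ : p.1 < 3 * n then .inr (⟨3 * n - 1 - p.1, by omega⟩, Fin.last n)
  else .inl (0, ⟨4 * n - 1 - p.1, by omega⟩)

/-- The two alternating boundary conditions `τ₊ = (bwbw…bw)` and `τ₋ = (wbwb…wb)`. -/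
inductive Bdry : Type
  | plus
  | minus

/-- The position, among the external edges `0, 1, …`, of the first black one. -/
def Bdry.offset : Bdry → ℕ
  | .plus => 0
  | .minus => 1

theorem Bdry.offset_lt (s : Bdry) : s.offset < 2 := by cases s <;> decide

/-- Edge colourings; `true` is black and `false` is white. -/
abbrev Colouring (n : ℕ) : Type := Edge n → Bool

/-- Each vertex is adjacent to two black and two white edges. -/
def IceRule {n : ℕ} (φ : Colouring n) : Prop :=
  ∀ v : Vertex n,
    ((incident v).filter fun e => φ e = true).card = 2 ∧
    ((incident v).filter fun e => φ e = false).card = 2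

/-- The colouring restricts to `τ₊`, resp. `τ₋`, on the external edges. -/
def HasBdry {n : ℕ} (s : Bdry) (φ : Colouring n) : Prop :=
  ∀ p : Fin (4 * n), φ (leg p) = true ↔ p.1 % 2 = s.offset

/-- The ensemble of fully-packed loop configurations `Fpl(n, ±)`. -/
def Fpl (n : ℕ) (s : Bdry) : Type := {φ : Colouring n // IceRule φ ∧ HasBdry s φ}

noncomputable instance (n : ℕ) (s : Bdry) : Fintype (Fpl n s) := by
  classical
  unfold Fpl
  infer_instance

/-- The black external edges, labelled in counter-clockwise order starting with the first
black one (the label `k + 1` in `1, …, 2 n` is the element `k` of `Fin (2 * n)`). -/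
def blackLeg {n : ℕ} (s : Bdry) (k : Fin (2 * n)) : Edge n :=
  leg ⟨2 * k.1 + s.offset, by have := s.offset_lt; omega⟩

/-- Two distinct black edges are joined when they share a vertex of the square, so that the
black open paths and cycles are the connected components of the black edges. -/
def blackGraph {n : ℕ} (φ : Colouring n) : SimpleGraph (Edge n) where
  Adj e f := e ≠ f ∧ φ e = true ∧ φ f = true ∧ ∃ v, e ∈ incident v ∧ f ∈ incident v
  symm := ⟨fun _ _ ⟨h, he, hf, v, hev, hfv⟩ => ⟨h.symm, hf, he, v, hfv, hev⟩⟩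
  loopless := ⟨fun _ h => h.1 rfl⟩

/-! ### The black open paths pair the black legs, without crossings -/

theorem incident_card {n : ℕ} (v : Vertex n) : (incident v).card = 4 := by
  obtain ⟨x, y⟩ := v
  simp [incident, Fin.ext_iff]

theorem incident_unique {n : ℕ} {v w : Vertex n} {e f : Edge n} (hef : e ≠ f)
    (hev : e ∈ incident v) (hfv : f ∈ incident v) (hew : e ∈ incident w) (hfw : f ∈ incident w) :
    v = w := by
  obtain ⟨x, y⟩ := v
  obtain ⟨x', y'⟩ := w
  rcases e with ⟨a, b⟩ | ⟨a, b⟩ <;> rcases f with ⟨c, d⟩ | ⟨c, d⟩ <;>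
    simp [incident, Fin.ext_iff] at hef hev hfv hew hfw ⊢ <;> omega

theorem leg_injective {n : ℕ} : Function.Injective (leg (n := n)) := by
  intro p q h
  unfold leg at h
  have := p.2
  have := q.2
  ext
  split_ifs at h <;> simp [Fin.ext_iff] at h <;> omega

theorem ends_card {n : ℕ} (e : Edge n) :
    ((Finset.univ.filter fun v : Vertex n => e ∈ incident v).card = 1 ∧ ∃ p, leg p = e) ∨
    ((Finset.univ.filter fun v : Vertex n => e ∈ incident v).card = 2 ∧ ∀ p, leg p ≠ e) := by
  have key : ∀ v w : Vertex n, v ≠ w → (∀ u, e ∈ incident u ↔ u = v ∨ u = w) →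
      (Finset.univ.filter fun v : Vertex n => e ∈ incident v).card = 2 := by
    intro v w hvw h
    rw [Finset.card_eq_two]
    exact ⟨v, w, hvw, by ext u; simp [h]⟩
  have key' : ∀ v : Vertex n, (∀ u, e ∈ incident u ↔ u = v) →
      (Finset.univ.filter fun v : Vertex n => e ∈ incident v).card = 1 := by
    intro v h
    rw [Finset.card_eq_one]
    exact ⟨v, by ext u; simp [h]⟩
  rcases e with ⟨⟨x, hx⟩, ⟨y, hy⟩⟩ | ⟨⟨x, hx⟩, ⟨y, hy⟩⟩
  · by_cases h0 : x = 0
    · left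
      refine ⟨key' (⟨0, by omega⟩, ⟨y, hy⟩) ?_, ⟨4 * n - 1 - y, by omega⟩, ?_⟩
      · rintro ⟨⟨a, ha⟩, ⟨b, hb⟩⟩
        simp [incident, Fin.ext_iff]
        omega
      · unfold leg
        simp only
        rw [dif_neg (by omega), dif_neg (by omega), dif_neg (by omega)]
        simp [Fin.ext_iff]
        omega
    by_cases hn : x = n
    · left
      refine ⟨key' (⟨n - 1, by omega⟩, ⟨y, hy⟩) ?_, ⟨n + y, by omega⟩, ?_⟩
      · rintro ⟨⟨a, ha⟩, ⟨b, hb⟩⟩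
        simp [incident, Fin.ext_iff]
        omega
      · unfold leg
        simp only
        rw [dif_neg (by omega), dif_pos (by omega)]
        simp [Fin.ext_iff]
        omega
    right
    refine ⟨key (⟨x - 1, by omega⟩, ⟨y, hy⟩) (⟨x, by omega⟩, ⟨y, hy⟩) ?_ ?_, ?_⟩
    · simp [Fin.ext_iff]
      omega
    · rintro ⟨⟨a, ha⟩, ⟨b, hb⟩⟩
      simp [incident, Fin.ext_iff]
      omega
    · intro p h
      unfold leg at h
      split_ifs at h <;> simp [Fin.ext_iff] at h <;> omega
  · by_cases h0 : y = 0
    · left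
      refine ⟨key' (⟨x, hx⟩, ⟨0, by omega⟩) ?_, ⟨x, by omega⟩, ?_⟩
      · rintro ⟨⟨a, ha⟩, ⟨b, hb⟩⟩
        simp [incident, Fin.ext_iff]
        omega
      · unfold leg
        simp only
        rw [dif_pos (by omega)]
        simp [Fin.ext_iff]
        omega
    by_cases hn : y = n
    · left
      refine ⟨key' (⟨x, hx⟩, ⟨n - 1, by omega⟩) ?_, ⟨3 * n - 1 - x, by omega⟩, ?_⟩
      · rintro ⟨⟨a, ha⟩, ⟨b, hb⟩⟩
        simp [incident, Fin.ext_iff]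
        omega
      · unfold leg
        simp only
        rw [dif_neg (by omega), dif_neg (by omega), dif_pos (by omega)]
        simp [Fin.ext_iff]
        omega
    right
    refine ⟨key (⟨x, hx⟩, ⟨y - 1, by omega⟩) (⟨x, hx⟩, ⟨y, by omega⟩) ?_ ?_, ?_⟩
    · simp [Fin.ext_iff]
      omega
    · rintro ⟨⟨a, ha⟩, ⟨b, hb⟩⟩
      simp [incident, Fin.ext_iff]
      omega
    · intro p h
      unfold leg at h
      split_ifs at h <;> simp [Fin.ext_iff] at h <;> omega

theorem blackGraph_degree {n : ℕ} {φ : Colouring n} (hφ : IceRule φ)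
    [DecidableRel (blackGraph φ).Adj] {e : Edge n} (he : φ e = true) :
    (blackGraph φ).degree e = (Finset.univ.filter fun v : Vertex n => e ∈ incident v).card := by
  classical
  have h : (blackGraph φ).neighborFinset e =
      (Finset.univ.filter fun v : Vertex n => e ∈ incident v).biUnion
        fun v => ((incident v).filter fun f => φ f = true).erase e := by
    ext f
    rw [SimpleGraph.mem_neighborFinset]
    simp only [blackGraph, Finset.mem_biUnion, Finset.mem_filter,
      Finset.mem_univ, true_and, Finset.mem_erase]
    constructor
    · rintro ⟨hne, _, hf, v, hev, hfv⟩
      exact ⟨v, hev, hne.symm, hfv, hf⟩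
    · rintro ⟨v, hev, hne, hfv, hf⟩
      exact ⟨hne.symm, he, hf, v, hev, hfv⟩
  rw [← SimpleGraph.card_neighborFinset_eq_degree, h, Finset.card_biUnion]
  · rw [Finset.card_eq_sum_ones]
    refine Finset.sum_congr rfl fun v hv => ?_
    rw [Finset.mem_filter] at hv
    rw [Finset.card_erase_of_mem (by simp [hv.2, he]), (hφ v).1]
  · intro v hv w hw hvw
    rw [Function.onFun, Finset.disjoint_left]
    intro f hf hf'
    simp only [Finset.mem_filter, Finset.mem_univ, true_and, Finset.mem_erase,
      Finset.coe_filter, Set.mem_ofPred_eq] at hv hw hf hf'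
    exact hvw (incident_unique hf.1 hf.2.1 hv hf'.2.1 hw)

theorem blackLeg_injective {n : ℕ} (s : Bdry) : Function.Injective (blackLeg (n := n) s) := by
  intro k l h
  have := leg_injective h
  simp only [Fin.mk.injEq] at this
  ext
  omega

theorem blackLeg_black {n : ℕ} {s : Bdry} (φ : Fpl n s) (k : Fin (2 * n)) :
    φ.1 (blackLeg s k) = true := by
  have := s.offset_lt
  exact (φ.2.2 _).2 (by simp only; omega)

theorem black_of_reachable {n : ℕ} {φ : Colouring n} {e f : Edge n} (he : φ e = true)
    (h : (blackGraph φ).Reachable e f) : φ f = true := by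
  obtain ⟨w⟩ := h
  induction w with
  | nil => exact he
  | cons h _ ih => exact ih h.2.2.1

theorem exists_blackLeg {n : ℕ} {s : Bdry} (φ : Fpl n s) (p : Fin (4 * n))
    (hp : φ.1 (leg p) = true) : ∃ k, blackLeg s k = leg p := by
  have h := (φ.2.2 p).1 hp
  have := p.2
  refine ⟨⟨p.1 / 2, by omega⟩, ?_⟩
  unfold blackLeg
  congr 1
  ext
  simp only
  omega

/-- The black open path starting at a black leg ends at exactly one other black leg. -/
theorem existsUnique_mate {n : ℕ} {s : Bdry} (φ : Fpl n s) (k : Fin (2 * n)) :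
    ∃! l : Fin (2 * n), l ≠ k ∧ (blackGraph φ.1).Reachable (blackLeg s k) (blackLeg s l) := by
  classical
  have hd : ∀ e, φ.1 e = true → (blackGraph φ.1).degree e = 1 ∧ (∃ p, leg p = e) ∨
      (blackGraph φ.1).degree e = 2 ∧ ∀ p, leg p ≠ e := by
    intro e he
    rw [blackGraph_degree φ.2.1 he]
    exact ends_card e
  have hleg : ∀ l, (blackGraph φ.1).degree (blackLeg s l) = 1 := by
    intro l
    rcases hd _ (blackLeg_black φ l) with h | h
    · exact h.1
    · exact absurd rfl (h.2 _)
  obtain ⟨b, ⟨hb, hr, hb1⟩, huniq⟩ := existsUnique_other_end (blackGraph φ.1) (blackLeg s k)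
    (fun v hv => (hd v (black_of_reachable (blackLeg_black φ k) hv)).imp And.left And.left)
    (hleg k)
  have hbb := black_of_reachable (blackLeg_black φ k) hr
  rcases hd b hbb with ⟨_, p, rfl⟩ | h
  · obtain ⟨l, hl⟩ := exists_blackLeg φ p hbb
    refine ⟨l, ⟨?_, ?_⟩, ?_⟩
    · rintro rfl
      exact hb hl.symm
    · rwa [hl]
    · rintro l' ⟨hl', hr'⟩
      apply blackLeg_injective s
      rw [hl]
      exact huniq _ ⟨fun h => hl' (blackLeg_injective s h), hr', hleg l'⟩
  · omega

/-- A set of edges with an even number of edges at each vertex has a two-colouring of the faces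
that changes exactly across these edges. -/
theorem exists_faces {n : ℕ} (p : Edge n → ZMod 2)
    (hp : ∀ v : Vertex n, p (.inl (v.1.castSucc, v.2)) + p (.inl (v.1.succ, v.2)) +
      p (.inr (v.1, v.2.castSucc)) + p (.inr (v.1, v.2.succ)) = 0) :
    ∃ f : ℕ → ℕ → ZMod 2,
      (∀ x y (hx : x < n + 1) (hy : y < n), f x (y + 1) = f x y + p (.inl (⟨x, hx⟩, ⟨y, hy⟩))) ∧
      (∀ x y (hx : x < n) (hy : y < n + 1),
        f (x + 1) y = f x y + p (.inr (⟨x, hx⟩, ⟨y, hy⟩))) := by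
  let H : ℕ → ℕ → ZMod 2 := fun x y =>
    if h : x < n + 1 ∧ y < n then p (.inl (⟨x, h.1⟩, ⟨y, h.2⟩)) else 0
  let V : ℕ → ZMod 2 := fun x => if h : x < n then p (.inr (⟨x, h⟩, 0)) else 0
  have hH : ∀ x y (hx : x < n + 1) (hy : y < n), H x y = p (.inl (⟨x, hx⟩, ⟨y, hy⟩)) :=
    fun x y hx hy => dif_pos ⟨hx, hy⟩
  have h1 : ∀ x y (hx : x < n + 1) (hy : y < n),
      (∑ i ∈ Finset.range x, V i + ∑ j ∈ Finset.range (y + 1), H x j) =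
      (∑ i ∈ Finset.range x, V i + ∑ j ∈ Finset.range y, H x j) +
        p (.inl (⟨x, hx⟩, ⟨y, hy⟩)) := by
    intro x y hx hy
    rw [Finset.sum_range_succ, hH x y hx hy, add_assoc]
  have key : ∀ z a b c d : ZMod 2, a + b + c + d = 0 → z + c + b = z + a + d := by decide
  refine ⟨fun x y => ∑ i ∈ Finset.range x, V i + ∑ j ∈ Finset.range y, H x j, h1, ?_⟩
  intro x y
  induction y with
  | zero =>
    intro hx hy
    have hV : V x = p (.inr (⟨x, hx⟩, 0)) := dif_pos hx
    simp only [Finset.range_zero, Finset.sum_empty, add_zero, Finset.sum_range_succ, hV]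
    rfl
  | succ y ih =>
    intro hx hy
    have ih := ih hx (by omega)
    have hv := hp (⟨x, hx⟩, ⟨y, by omega⟩)
    simp only [Fin.castSucc_mk, Fin.succ_mk] at hv
    simp only at ih ⊢
    rw [h1 (x + 1) y (by omega) (by omega), h1 x y (by omega) (by omega), ih]
    exact key _ _ _ _ _ hv

theorem exists_boundary {n : ℕ} (p : Edge n → ZMod 2) (f : ℕ → ℕ → ZMod 2)
    (hH : ∀ x y (hx : x < n + 1) (hy : y < n), f x (y + 1) = f x y + p (.inl (⟨x, hx⟩, ⟨y, hy⟩)))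
    (hV : ∀ x y (hx : x < n) (hy : y < n + 1),
        f (x + 1) y = f x y + p (.inr (⟨x, hx⟩, ⟨y, hy⟩))) :
    ∃ F : ℕ → ZMod 2, (∀ m (hm : m < 4 * n), F (m + 1) = F m + p (leg ⟨m, hm⟩)) ∧
      ∀ m (hm : m < 4 * n), p (leg ⟨m, hm⟩) = 0 →
        Sum.elim (fun e => f e.1.1 e.2.1) (fun e => f e.1.1 e.2.1) (leg ⟨m, hm⟩) = F m := by
  let F : ℕ → ZMod 2 := fun m =>
    if m ≤ n then f m 0 else if m ≤ 2 * n then f n (m - n)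
    else if m ≤ 3 * n then f (3 * n - m) n else f 0 (4 * n - m)
  have hflip : ∀ a b c : ZMod 2, a = b + c → b = a + c := by decide
  have hstep : ∀ m (hm : m < 4 * n), F (m + 1) = F m + p (leg ⟨m, hm⟩) ∧
      (p (leg ⟨m, hm⟩) = 0 → Sum.elim (fun e : Fin (n + 1) × Fin n => f e.1.1 e.2.1)
        (fun e : Fin n × Fin (n + 1) => f e.1.1 e.2.1) (leg ⟨m, hm⟩) = F m) := by
    intro m hm
    by_cases h1 : m < n
    · have e0 : F m = f m 0 := if_pos (by omega)
      have e1 : F (m + 1) = f (m + 1) 0 := if_pos (by omega)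
      have el : leg ⟨m, hm⟩ = .inr (⟨m, h1⟩, 0) := by simp [leg, h1]
      rw [e0, e1, el]
      exact ⟨hV m 0 h1 (by omega), fun _ => rfl⟩
    by_cases h2 : m < 2 * n
    · have e0 : F m = f n (m - n) := by
        simp only [F]
        split_ifs with h
        · have : m = n := by omega
          subst this
          simp
        · rfl
        all_goals omega
      have e1 : F (m + 1) = f n (m - n + 1) := by
        simp only [F]
        rw [if_neg (by omega), if_pos (by omega)]
        congr 1
        omega
      have el : leg ⟨m, hm⟩ = .inl (Fin.last n, ⟨m - n, by omega⟩) := by simp [leg, h1, h2]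
      rw [e0, e1, el]
      exact ⟨hH n (m - n) (by omega) (by omega), fun _ => rfl⟩
    by_cases h3 : m < 3 * n
    · have e0 : F m = f (3 * n - 1 - m + 1) n := by
        simp only [F]
        split_ifs with h h'
        · omega
        · have : m = 2 * n := by omega
          subst this
          congr 1 <;> omega
        · congr 1
          omega
        · omega
      have e1 : F (m + 1) = f (3 * n - 1 - m) n := by
        simp only [F]
        rw [if_neg (by omega), if_neg (by omega), if_pos (by omega)]
        congr 1
        omega
      have el : leg ⟨m, hm⟩ = .inr (⟨3 * n - 1 - m, by omega⟩, Fin.last n) := by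
        simp [leg, h1, h2, h3]
      have hs := hV (3 * n - 1 - m) n (by omega) (by omega)
      rw [e0, e1, el]
      refine ⟨hflip _ _ _ hs, fun h0 => ?_⟩
      rw [hs]
      change f (3 * n - 1 - m) n = _
      change p (.inr (⟨3 * n - 1 - m, _⟩, ⟨n, _⟩)) = 0 at h0
      rw [h0, add_zero]
    · have e0 : F m = f 0 (4 * n - 1 - m + 1) := by
        simp only [F]
        split_ifs with h h' h''
        · omega
        · omega
        · have : m = 3 * n := by omega
          subst this
          congr 1 <;> omega
        · congr 1
          omega
      have e1 : F (m + 1) = f 0 (4 * n - 1 - m) := by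
        simp only [F]
        rw [if_neg (by omega), if_neg (by omega), if_neg (by omega)]
        congr 1
        omega
      have el : leg ⟨m, hm⟩ = .inl (0, ⟨4 * n - 1 - m, by omega⟩) := by
        simp [leg, h1, h2, h3]
      have hs := hH 0 (4 * n - 1 - m) (by omega) (by omega)
      rw [e0, e1, el]
      refine ⟨hflip _ _ _ hs, fun h0 => ?_⟩
      rw [hs]
      change f 0 (4 * n - 1 - m) = _
      change p (.inl (⟨0, _⟩, ⟨4 * n - 1 - m, _⟩)) = 0 at h0
      rw [h0, add_zero]
  exact ⟨F, fun m hm => (hstep m hm).1, fun m hm => (hstep m hm).2⟩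

/-- The component of a black edge has zero or two edges at each vertex. -/
theorem component_even {n : ℕ} {φ : Colouring n} (hφ : IceRule φ) {a : Edge n} (ha : φ a = true)
    (p : Edge n → ZMod 2) (hp1 : ∀ e, (blackGraph φ).Reachable a e → p e = 1)
    (hp0 : ∀ e, ¬ (blackGraph φ).Reachable a e → p e = 0) (v : Vertex n) :
    p (.inl (v.1.castSucc, v.2)) + p (.inl (v.1.succ, v.2)) +
      p (.inr (v.1, v.2.castSucc)) + p (.inr (v.1, v.2.succ)) = 0 := by
  classical
  have hsum : p (.inl (v.1.castSucc, v.2)) + p (.inl (v.1.succ, v.2)) +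
      p (.inr (v.1, v.2.castSucc)) + p (.inr (v.1, v.2.succ)) = ∑ e ∈ incident v, p e := by
    obtain ⟨x, y⟩ := v
    simp [incident, Fin.ext_iff, add_assoc]
  have hw : ∑ e ∈ incident v, p e = ∑ e ∈ (incident v).filter (fun e => φ e = true), p e := by
    rw [Finset.sum_filter]
    refine Finset.sum_congr rfl fun e _ => ?_
    split_ifs with h
    · rfl
    · exact hp0 e fun hr => h (black_of_reachable ha hr)
  obtain ⟨b, c, hbc, hS⟩ := Finset.card_eq_two.1 (hφ v).1
  have hb : b ∈ (incident v).filter (fun e => φ e = true) := by simp [hS]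
  have hc : c ∈ (incident v).filter (fun e => φ e = true) := by simp [hS]
  rw [Finset.mem_filter] at hb hc
  have hadj : (blackGraph φ).Adj b c := ⟨hbc, hb.2, hc.2, v, hb.1, hc.1⟩
  rw [hsum, hw, hS, Finset.sum_pair hbc]
  by_cases h : (blackGraph φ).Reachable a b
  · rw [hp1 b h, hp1 c (h.trans hadj.reachable)]
    decide
  · rw [hp0 b h, hp0 c fun h' => h (h'.trans hadj.symm.reachable)]
    decide

/-- Two black open paths do not cross. -/
theorem not_crossing {n : ℕ} {s : Bdry} (φ : Fpl n s) {i j i' j' : Fin (2 * n)}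
    (hi : (blackGraph φ.1).Reachable (blackLeg s i) (blackLeg s i'))
    (hj : (blackGraph φ.1).Reachable (blackLeg s j) (blackLeg s j')) :
    ¬ (i < j ∧ j < i' ∧ i' < j') := by
  classical
  rintro ⟨h1, h2, h3⟩
  let p : Edge n → ZMod 2 := fun e => if (blackGraph φ.1).Reachable (blackLeg s i) e then 1 else 0
  have hp1 : ∀ e, (blackGraph φ.1).Reachable (blackLeg s i) e → p e = 1 := fun e h => if_pos h
  have hp0 : ∀ e, ¬ (blackGraph φ.1).Reachable (blackLeg s i) e → p e = 0 := fun e h => if_neg h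
  obtain ⟨f, hH, hV⟩ := exists_faces p (component_even φ.2.1 (blackLeg_black φ i) p hp1 hp0)
  obtain ⟨F, hF, hside⟩ := exists_boundary p f hH hV
  have honly : ∀ l, p (blackLeg s l) ≠ 0 → l = i ∨ l = i' := by
    intro l hl
    by_contra hne
    push Not at hne
    have hr : (blackGraph φ.1).Reachable (blackLeg s i) (blackLeg s l) := by
      by_contra h
      exact hl (hp0 _ h)
    exact hne.2 ((existsUnique_mate φ i).unique ⟨hne.1, hr⟩ ⟨by omega, hi⟩)
  have hnot : ∀ e, (blackGraph φ.1).Reachable (blackLeg s j) e → p e = 0 := by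
    intro e he
    by_contra h
    have hr : (blackGraph φ.1).Reachable (blackLeg s i) e := by
      by_contra h'
      exact h (hp0 _ h')
    have hij : p (blackLeg s j) ≠ 0 := by
      rw [hp1 _ (hr.trans he.symm)]
      decide
    rcases honly j hij with h | h <;> omega
  let g : Edge n → ZMod 2 := Sum.elim (fun e => f e.1.1 e.2.1) (fun e => f e.1.1 e.2.1)
  -- all four faces around a vertex of the second path agree
  have hvert : ∀ e e', (blackGraph φ.1).Reachable (blackLeg s j) e →
      (blackGraph φ.1).Adj e e' → g e = g e' := by
    rintro e e' hr ⟨hne, he, he', v, hev, hev'⟩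
    have hr' : (blackGraph φ.1).Reachable (blackLeg s j) e' :=
      hr.trans (SimpleGraph.Adj.reachable ⟨hne, he, he', v, hev, hev'⟩)
    have hz : ∀ d ∈ incident v, p d = 0 := by
      intro d hd
      by_cases hde : d = e
      · rw [hde]; exact hnot e hr
      by_contra h
      have hrd : (blackGraph φ.1).Reachable (blackLeg s i) d := by
        by_contra h'
        exact h (hp0 _ h')
      have hdb := black_of_reachable (blackLeg_black φ i) hrd
      exact h (hnot d (hr.trans (SimpleGraph.Adj.reachable ⟨Ne.symm hde, he, hdb, v, hev, hd⟩)))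
    obtain ⟨⟨x, hx⟩, ⟨y, hy⟩⟩ := v
    have e1 : f x (y + 1) = f x y := by
      rw [hH x y (by omega) hy, hz _ (by simp [incident]), add_zero]
    have e2 : f (x + 1) y = f x y := by
      rw [hV x y hx (by omega), hz _ (by simp [incident]), add_zero]
    have hg : ∀ d ∈ incident ((⟨x, hx⟩, ⟨y, hy⟩) : Vertex n), g d = f x y := by
      intro d hd
      simp only [incident, Finset.mem_insert, Finset.mem_singleton] at hd
      rcases hd with rfl | rfl | rfl | rfl
      · rfl
      · exact e2
      · rfl
      · exact e1
    rw [hg e hev, hg e' hev']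
  have hconst : ∀ e e', (blackGraph φ.1).Reachable (blackLeg s j) e →
      (blackGraph φ.1).Reachable e e' → g e = g e' := by
    rintro e e' hr ⟨w⟩
    induction w with
    | nil => rfl
    | cons h _ ih => exact (hvert _ _ hr h).trans (ih (hr.trans h.reachable))
  have hs := s.offset_lt
  have hgj : ∀ l : Fin (2 * n), (blackGraph φ.1).Reachable (blackLeg s j) (blackLeg s l) →
      g (blackLeg s l) = F (2 * l.1 + s.offset) := fun l hl => hside _ _ (hnot _ hl)
  have hFF : F (2 * j.1 + s.offset) = F (2 * j'.1 + s.offset) := by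
    rw [← hgj j (SimpleGraph.Reachable.refl _), ← hgj j' hj]
    exact hconst _ _ (SimpleGraph.Reachable.refl _) hj
  have hzero : ∀ m (hm : m < 4 * n), m ≠ 2 * i.1 + s.offset → m ≠ 2 * i'.1 + s.offset →
      p (leg ⟨m, hm⟩) = 0 := by
    intro m hm hmi hmi'
    by_contra h
    have hr : (blackGraph φ.1).Reachable (blackLeg s i) (leg ⟨m, hm⟩) := by
      by_contra h'
      exact h (hp0 _ h')
    obtain ⟨l, hl⟩ := exists_blackLeg φ _ (black_of_reachable (blackLeg_black φ i) hr)
    have hlm := leg_injective hl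
    simp only [Fin.mk.injEq] at hlm
    rcases honly l (by rw [hl]; exact h) with rfl | rfl <;> omega
  have hrun : ∀ a b, a ≤ b → b ≤ 4 * n →
      (∀ m, a ≤ m → m < b → m ≠ 2 * i.1 + s.offset ∧ m ≠ 2 * i'.1 + s.offset) → F b = F a := by
    intro a b hab
    induction b, hab using Nat.le_induction with
    | base => intros; rfl
    | succ b hab ih =>
      intro hb hm
      rw [hF b (by omega), hzero b (by omega) (hm b hab (by omega)).1 (hm b hab (by omega)).2,
        add_zero, ih (by omega) fun m h h' => hm m h (by omega)]
  have hA := hrun (2 * j.1 + s.offset) (2 * i'.1 + s.offset) (by omega) (by omega)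
    (fun m _ _ => by omega)
  have hB := hrun (2 * i'.1 + s.offset + 1) (2 * j'.1 + s.offset) (by omega) (by omega)
    (fun m _ _ => by omega)
  have hC := hF (2 * i'.1 + s.offset) (by omega)
  have hone : p (leg ⟨2 * i'.1 + s.offset, by omega⟩) = 1 := hp1 _ hi
  rw [hone] at hC
  rw [hB, hC, hA] at hFF
  revert hFF
  generalize F (2 * j.1 + s.offset) = z
  revert z
  decide

/-! ### Link patterns -/

/-- Link patterns: non-crossing perfect matchings of `2 n` cyclically ordered points.
`mate i` is the point matched to `i`. -/
@[ext]
structure LinkPattern (n : ℕ) where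
  mate : Fin (2 * n) → Fin (2 * n)
  mate_mate : ∀ i, mate (mate i) = i
  mate_ne : ∀ i, mate i ≠ i
  noncrossing : ∀ i j, ¬ (i < j ∧ j < mate i ∧ mate i < mate j)

/-- The link pattern `π(φ)`: two labels are matched when the corresponding black legs are the
two ends of a black open path. -/
noncomputable def linkPattern {n : ℕ} {s : Bdry} (φ : Fpl n s) : LinkPattern n where
  mate k := (existsUnique_mate φ k).choose
  mate_mate k := by
    have h := (existsUnique_mate φ k).choose_spec.1
    exact (existsUnique_mate φ _).unique (existsUnique_mate φ _).choose_spec.1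
      ⟨h.1.symm, h.2.symm⟩
  mate_ne k := (existsUnique_mate φ k).choose_spec.1.1
  noncrossing i j := not_crossing φ (existsUnique_mate φ i).choose_spec.1.2
    (existsUnique_mate φ j).choose_spec.1.2

theorem finRotate_val {m : ℕ} (i : Fin m) :
    (finRotate m i).1 = if i.1 + 1 = m then 0 else i.1 + 1 := by
  cases m with
  | zero => exact i.elim0
  | succ m =>
    rw [coe_finRotate]
    simp [Fin.ext_iff]

theorem finRotate_symm_val {m : ℕ} (i : Fin m) :
    ((finRotate m).symm i).1 = if i.1 = 0 then m - 1 else i.1 - 1 := by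
  have h := finRotate_val ((finRotate m).symm i)
  rw [Equiv.apply_symm_apply] at h
  have := ((finRotate m).symm i).2
  split_ifs at h ⊢ <;> omega

/-- The rotation `R`, which replaces each matched pair `(i, j)` by `(i - 1, j - 1)`
(labels modulo `2 n`). -/
def rotate {n : ℕ} (π : LinkPattern n) : LinkPattern n where
  mate i := (finRotate (2 * n)).symm (π.mate (finRotate (2 * n) i))
  mate_mate i := by rw [Equiv.apply_symm_apply, π.mate_mate, Equiv.symm_apply_apply]
  mate_ne i := by
    intro h
    rw [Equiv.symm_apply_eq] at h
    exact π.mate_ne _ h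
  noncrossing i j := by
    rintro ⟨h1, h2, h3⟩
    have hi := finRotate_val i
    have hj := finRotate_val j
    generalize finRotate (2 * n) i = I at *
    generalize finRotate (2 * n) j = J at *
    have ha := finRotate_symm_val (π.mate I)
    have hb := finRotate_symm_val (π.mate J)
    rw [Fin.lt_def] at h1 h2 h3
    have hi' := i.2
    have hj' := j.2
    have ha' := (π.mate I).2
    have hb' := (π.mate J).2
    generalize ((finRotate (2 * n)).symm (π.mate I)).1 = a at *
    generalize ((finRotate (2 * n)).symm (π.mate J)).1 = b at *
    by_cases h0 : (π.mate J).1 = 0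
    · have hm := π.mate_mate J
      apply π.noncrossing (π.mate J) I
      rw [hm]
      simp only [Fin.lt_def]
      split_ifs at hi hj ha hb <;> omega
    · apply π.noncrossing I J
      simp only [Fin.lt_def]
      split_ifs at hi hj ha hb <;> omega

/-- The inverse rotation. -/
def unrotate {n : ℕ} (π : LinkPattern n) : LinkPattern n where
  mate i := finRotate (2 * n) (π.mate ((finRotate (2 * n)).symm i))
  mate_mate i := by rw [Equiv.symm_apply_apply, π.mate_mate, Equiv.apply_symm_apply]
  mate_ne i := by
    intro h
    rw [← Equiv.eq_symm_apply] at h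
    exact π.mate_ne _ h
  noncrossing i j := by
    rintro ⟨h1, h2, h3⟩
    have hi := finRotate_symm_val i
    have hj := finRotate_symm_val j
    generalize (finRotate (2 * n)).symm i = I at *
    generalize (finRotate (2 * n)).symm j = J at *
    have ha := finRotate_val (π.mate I)
    have hb := finRotate_val (π.mate J)
    rw [Fin.lt_def] at h1 h2 h3
    have hi' := i.2
    have hj' := j.2
    have ha' := (π.mate I).2
    have hb' := (π.mate J).2
    have hA := (finRotate (2 * n) (π.mate I)).2
    have hB := (finRotate (2 * n) (π.mate J)).2
    generalize (finRotate (2 * n) (π.mate I)).1 = a at *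
    generalize (finRotate (2 * n) (π.mate J)).1 = b at *
    by_cases h0 : i.1 = 0
    · have hm := π.mate_mate I
      apply π.noncrossing J (π.mate I)
      rw [hm]
      simp only [Fin.lt_def]
      split_ifs at hi hj ha hb <;> omega
    · apply π.noncrossing I J
      simp only [Fin.lt_def]
      split_ifs at hi hj ha hb <;> omega

/-- The rotation `R` as a permutation of `LP(n)`. -/
def rotation (n : ℕ) : Equiv.Perm (LinkPattern n) where
  toFun := rotate
  invFun := unrotate
  left_inv π := by
    apply LinkPattern.ext
    funext i
    simp only [rotate, unrotate, Equiv.apply_symm_apply]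
  right_inv π := by
    apply LinkPattern.ext
    funext i
    simp only [rotate, unrotate, Equiv.symm_apply_apply]

/-- `π ∼ π'` iff `π' = R ^ k π` for some integer `k`. -/
abbrev rotationSetoid (n : ℕ) : Setoid (LinkPattern n) :=
  Equiv.Perm.SameCycle.setoid (rotation n)

/-- Link patterns up to rotation, `LP*(n)`. -/
abbrev RotationClass (n : ℕ) : Type := Quotient (rotationSetoid n)

/-- The rotation class `[π]`. -/
abbrev rotationClass {n : ℕ} (π : LinkPattern n) : RotationClass n :=
  Quotient.mk (rotationSetoid n) π

open Classical in
/-- The refined subsets `Fpl(n, ±; [π])`. -/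
noncomputable def fplClass {n : ℕ} (s : Bdry) (c : RotationClass n) : Finset (Fpl n s) :=
  Finset.univ.filter fun φ => rotationClass (linkPattern φ) = c

/-! ### Plaquettes -/

/-- Plaquettes of the square: the plaquette `(x, y)` is the unit square with corners
`(x, y)`, `(x + 1, y)`, `(x, y + 1)`, `(x + 1, y + 1)`. -/
abbrev Plaquette (n : ℕ) : Type := Fin (n - 1) × Fin (n - 1)

/-- The four sides of a plaquette. -/
def Plaquette.bottom {n : ℕ} (α : Plaquette n) : Edge n :=
  .inl (⟨α.1.1 + 1, by omega⟩, ⟨α.2.1, by omega⟩)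

def Plaquette.top {n : ℕ} (α : Plaquette n) : Edge n :=
  .inl (⟨α.1.1 + 1, by omega⟩, ⟨α.2.1 + 1, by omega⟩)

def Plaquette.left {n : ℕ} (α : Plaquette n) : Edge n :=
  .inr (⟨α.1.1, by omega⟩, ⟨α.2.1 + 1, by omega⟩)

def Plaquette.right {n : ℕ} (α : Plaquette n) : Edge n :=
  .inr (⟨α.1.1 + 1, by omega⟩, ⟨α.2.1 + 1, by omega⟩)

/-- `N_α(φ)`: `+1` if the horizontal sides of `α` are black and the vertical ones white, `-1` if
the horizontal sides are white and the vertical ones black, and `0` otherwise. -/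
def plaquetteSign {n : ℕ} (α : Plaquette n) (φ : Colouring n) : ℤ :=
  if φ α.bottom = true ∧ φ α.top = true ∧ φ α.left = false ∧ φ α.right = false then 1
  else if φ α.bottom = false ∧ φ α.top = false ∧ φ α.left = true ∧ φ α.right = true then -1
  else 0

/-! ### Vector notation -/

/-- The state `∑ |φ⟩⟩`, sum over all `φ ∈ Fpl(n, ±)`, in `ℂ ^ Fpl(n, ±)`. -/
noncomputable def allFpl (n : ℕ) (s : Bdry) : Fpl n s →₀ ℂ :=
  ∑ φ : Fpl n s, Finsupp.single φ 1

/-- The diagonal operator `|φ⟩⟩ ↦ N_α(φ) |φ⟩⟩` on `ℂ ^ Fpl(n, ±)`. -/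
noncomputable def signOp {n : ℕ} (s : Bdry) (α : Plaquette n) :
    (Fpl n s →₀ ℂ) →ₗ[ℂ] (Fpl n s →₀ ℂ) :=
  Finsupp.lsum ℂ fun φ : Fpl n s => (plaquetteSign α φ.1 : ℂ) • Finsupp.lsingle φ

/-- The linear map `Π_± : |φ⟩⟩ ↦ |π(φ)⟩`. -/
noncomputable def projOp (n : ℕ) (s : Bdry) : (Fpl n s →₀ ℂ) →ₗ[ℂ] (LinkPattern n →₀ ℂ) :=
  Finsupp.lmapDomain ℂ ℂ linkPattern

/-- The linear map `R : |π⟩ ↦ |R π⟩`. -/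
noncomputable def rotOp (n : ℕ) : (LinkPattern n →₀ ℂ) →ₗ[ℂ] (LinkPattern n →₀ ℂ) :=
  Finsupp.lmapDomain ℂ ℂ (rotation n)

/-- `Sym = 1 + R + ⋯ + R ^ (2 n - 1)`. -/
noncomputable def symOp (n : ℕ) : (LinkPattern n →₀ ℂ) →ₗ[ℂ] (LinkPattern n →₀ ℂ) :=
  ∑ k ∈ Finset.range (2 * n), rotOp n ^ k

end FPL

namespace FPL

/-! ### Half-gyrations -/

/-! The proof uses Wieland's half-gyrations, composed with a global exchange of colours. Add to the
plaquettes the faces along the boundary. Faces of one parity `ε` cover every edge exactly once; on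
each such face all sides are complemented unless the face is alternating (sign ±1), in which case
they are kept. This is an involution on colourings. It preserves the ice rule, exchanges the two
boundary conditions, and does not change the signs of the active faces.

Black paths keep joining the same active boundary faces (`reachable_gyrate`). Such a face carries
two consecutive legs, one black before and the other after, so from `+` to `-` the link pattern is
unchanged for one parity and rotated by one step for the other. Hence both half-gyrations are
bijections between the `+` and `-` configurations of a given rotation class.

The existence of two bijections gives the theorem. For a vertical edge, its colour (±1) before plus
its colour after is `-2` times the sign of its active face (`colourSign_gyrate`). Summed over a
class, the left side is the total over both boundary conditions and does not depend on the parity.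
So the two faces on either side of a vertical edge have the same total sign; moving along a row to
the boundary, where the sign is `0`, all totals vanish. The `-` case follows because a half-gyration
preserves the signs of its active faces. The vector form holds because `Sym` of a basis vector
depends only on its rotation class. -/

/-- The opposite boundary condition. -/
def Bdry.flip : Bdry → Bdry
  | .plus => .minus
  | .minus => .plus

/-- The face `(x, y)` is the unit square with corners `(x - 1, y - 1)` and `(x, y)`. Every edge
is a side of exactly one face with `(x + y) % 2 = ε`. -/
def activeFace {n : ℕ} (ε : ℕ) : Edge n → ℕ × ℕ
  | .inl (x, y) => (x.1, y.1 + (x.1 + y.1 + ε) % 2)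
  | .inr (x, y) => (x.1 + (x.1 + y.1 + ε) % 2, y.1)

/-- `N` on all faces, with value `0` on those at the boundary. -/
def faceSign {n : ℕ} (φ : Colouring n) (f : ℕ × ℕ) : ℤ :=
  if h : (1 ≤ f.1 ∧ f.1 < n) ∧ 1 ≤ f.2 ∧ f.2 < n then
    plaquetteSign (n := n) (⟨f.1 - 1, by omega⟩, ⟨f.2 - 1, by omega⟩) φ
  else 0

/-- The half-gyration: complement the sides of each active face that is not alternating. -/
def gyrate {n : ℕ} (ε : ℕ) (φ : Colouring n) : Colouring n :=
  fun e => if faceSign φ (activeFace ε e) = 0 then !φ e else φ e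

theorem faceSign_plaquette {n : ℕ} (φ : Colouring n) (α : Plaquette n) :
    faceSign φ (α.1.1 + 1, α.2.1 + 1) = plaquetteSign α φ := by
  have h1 := α.1.2
  have h2 := α.2.2
  unfold faceSign
  rw [dif_pos (by simp only; omega)]
  simp

theorem exists_plaquette {n : ℕ} {φ : Colouring n} {f : ℕ × ℕ} (h : faceSign φ f ≠ 0) :
    ∃ α : Plaquette n, f = (α.1.1 + 1, α.2.1 + 1) := by
  unfold faceSign at h
  split_ifs at h with h'
  · refine ⟨(⟨f.1 - 1, by omega⟩, ⟨f.2 - 1, by omega⟩), ?_⟩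
    ext <;> simp only <;> omega
  · exact absurd rfl h

theorem mem_sides {n : ℕ} {ε : ℕ} {e : Edge n} {α : Plaquette n}
    (h : activeFace ε e = (α.1.1 + 1, α.2.1 + 1)) :
    (e.isLeft = true ∧ (e = α.bottom ∨ e = α.top)) ∨
    (e.isLeft = false ∧ (e = α.left ∨ e = α.right)) := by
  rcases e with ⟨⟨x, hx⟩, ⟨y, hy⟩⟩ | ⟨⟨x, hx⟩, ⟨y, hy⟩⟩ <;>
    simp only [activeFace, Plaquette.bottom, Plaquette.top, Plaquette.left, Plaquette.right] at h ⊢ <;>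
    simp [Fin.ext_iff] at h ⊢ <;> omega

theorem activeFace_sides {n : ℕ} {ε : ℕ} {α : Plaquette n} (hα : (α.1.1 + α.2.1 + ε) % 2 = 0) :
    activeFace ε α.bottom = (α.1.1 + 1, α.2.1 + 1) ∧ activeFace ε α.top = (α.1.1 + 1, α.2.1 + 1) ∧
    activeFace ε α.left = (α.1.1 + 1, α.2.1 + 1) ∧ activeFace ε α.right = (α.1.1 + 1, α.2.1 + 1) := by
  simp only [activeFace, Plaquette.bottom, Plaquette.top, Plaquette.left, Plaquette.right]
  refine ⟨?_, ?_, ?_, ?_⟩ <;> simp only [Prod.mk.injEq, true_and, and_true] <;> omega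

theorem activeFace_parity {n : ℕ} {ε : ℕ} (hε : ε < 2) (e : Edge n) :
    ((activeFace ε e).1 + (activeFace ε e).2) % 2 = ε := by
  rcases e with ⟨⟨x, hx⟩, ⟨y, hy⟩⟩ | ⟨⟨x, hx⟩, ⟨y, hy⟩⟩ <;> simp only [activeFace] <;> omega

/-- One side of an alternating face determines its sign: `isLeft` marks horizontal edges, which are
black exactly for sign `+1`, while vertical ones are black exactly for `-1`. -/
theorem faceSign_colour {n : ℕ} {φ : Colouring n} {ε : ℕ} {e : Edge n}
    (h : faceSign φ (activeFace ε e) ≠ 0) :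
    faceSign φ (activeFace ε e) = if φ e = e.isLeft then 1 else -1 := by
  obtain ⟨α, hα⟩ := exists_plaquette h
  rw [hα, faceSign_plaquette] at h ⊢
  unfold plaquetteSign at h ⊢
  rcases mem_sides hα with ⟨h1, rfl | rfl⟩ | ⟨h1, rfl | rfl⟩ <;> rw [h1] <;>
    split_ifs at h ⊢ <;> simp_all

/-- With the parity of `f` itself, the four sides of `f` are kept or complemented together, and the
complement of a non-alternating face is not alternating. -/
theorem faceSign_gyrate {n : ℕ} (φ : Colouring n) {f : ℕ × ℕ} :
    faceSign (gyrate ((f.1 + f.2) % 2) φ) f = faceSign φ f := by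
  by_cases hf : (1 ≤ f.1 ∧ f.1 < n) ∧ 1 ≤ f.2 ∧ f.2 < n
  · obtain ⟨α, rfl⟩ : ∃ α : Plaquette n, f = (α.1.1 + 1, α.2.1 + 1) := by
      refine ⟨(⟨f.1 - 1, by omega⟩, ⟨f.2 - 1, by omega⟩), ?_⟩
      ext <;> simp only <;> omega
    obtain ⟨h1, h2, h3, h4⟩ := activeFace_sides (α := α)
      (ε := (α.1.1 + 1 + (α.2.1 + 1)) % 2) (by omega)
    rw [faceSign_plaquette, faceSign_plaquette]
    unfold plaquetteSign gyrate
    rw [h1, h2, h3, h4, faceSign_plaquette]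
    unfold plaquetteSign
    generalize φ α.bottom = a
    generalize φ α.top = b
    generalize φ α.left = c
    generalize φ α.right = d
    revert a b c d
    decide
  · unfold faceSign
    rw [dif_neg hf, dif_neg hf]

theorem faceSign_gyrate_activeFace {n : ℕ} {ε : ℕ} (hε : ε < 2) (φ : Colouring n) (e : Edge n) :
    faceSign (gyrate ε φ) (activeFace ε e) = faceSign φ (activeFace ε e) := by
  have := faceSign_gyrate φ (f := activeFace ε e)
  rwa [activeFace_parity hε] at this

theorem gyrate_gyrate {n : ℕ} {ε : ℕ} (hε : ε < 2) (φ : Colouring n) :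
    gyrate ε (gyrate ε φ) = φ := by
  funext e
  rw [gyrate, faceSign_gyrate_activeFace hε, gyrate]
  split_ifs <;> simp

/-- Two edges at a vertex that are sides of the same face are perpendicular. -/
theorem isLeft_ne {n : ℕ} {ε : ℕ} {v : Vertex n} {e g : Edge n} (hev : e ∈ incident v)
    (hgv : g ∈ incident v) (hne : e ≠ g) (h : activeFace ε e = activeFace ε g) :
    e.isLeft = !g.isLeft := by
  obtain ⟨⟨a, ha⟩, ⟨b, hb⟩⟩ := v
  rcases e with ⟨⟨x, hx⟩, ⟨y, hy⟩⟩ | ⟨⟨x, hx⟩, ⟨y, hy⟩⟩ <;>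
    rcases g with ⟨⟨x', hx'⟩, ⟨y', hy'⟩⟩ | ⟨⟨x', hx'⟩, ⟨y', hy'⟩⟩ <;>
    simp [incident, Fin.ext_iff] at hev hgv hne ⊢ <;> simp only [activeFace, Prod.mk.injEq] at h <;>
    omega

/-! ### Ice rule and boundary condition under a half-gyration. -/

theorem gyrate_corner {n : ℕ} {ε : ℕ} (φ : Colouring n) {v : Vertex n} {e g : Edge n}
    (hev : e ∈ incident v) (hgv : g ∈ incident v) (hne : e ≠ g)
    (h : activeFace ε e = activeFace ε g) :
    gyrate ε φ e = !φ e ∧ gyrate ε φ g = !φ g ∨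
      gyrate ε φ e = φ e ∧ gyrate ε φ g = φ g ∧ φ e = !φ g := by
  by_cases h0 : faceSign φ (activeFace ε e) = 0
  · left
    simp [gyrate, ← h, h0]
  · right
    refine ⟨by simp [gyrate, h0], by simp [gyrate, ← h, h0], ?_⟩
    have h1 := faceSign_colour h0
    have h2 := faceSign_colour (h ▸ h0 : faceSign φ (activeFace ε g) ≠ 0)
    rw [← h, h1, isLeft_ne hev hgv hne h] at h2
    revert h2
    generalize φ e = a
    generalize φ g = b
    generalize g.isLeft = c
    revert a b c
    decide

theorem card_filter_incident {n : ℕ} (φ : Colouring n) (v : Vertex n) (c : Bool) :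
    ((incident v).filter fun e => φ e = c).card =
      (if φ (.inl (v.1.castSucc, v.2)) = c then 1 else 0) +
      ((if φ (.inl (v.1.succ, v.2)) = c then 1 else 0) +
      ((if φ (.inr (v.1, v.2.castSucc)) = c then 1 else 0) +
      (if φ (.inr (v.1, v.2.succ)) = c then 1 else 0))) := by
  obtain ⟨x, y⟩ := v
  rw [Finset.card_filter, incident, Finset.sum_insert, Finset.sum_insert, Finset.sum_insert,
    Finset.sum_singleton] <;> simp [Fin.ext_iff]

/-- The edges at a vertex form two corners of active faces. A kept corner has one black edge and one
white; if the other corner is complemented, it too had one of each and still does. If both corners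
are complemented, two black and two white edges are exchanged. -/
theorem IceRule.gyrate {n : ℕ} {ε : ℕ} (hε : ε < 2) {φ : Colouring n} (hφ : IceRule φ) :
    IceRule (gyrate ε φ) := by
  intro v
  have h := hφ v
  simp only [card_filter_incident] at h ⊢
  -- The parity decides whether the active faces at `v` are the lower-left and upper-right ones or
  -- the upper-left and lower-right ones.
  by_cases hp : (v.1.1 + v.2.1) % 2 = ε
  · have h1 := gyrate_corner (ε := ε) φ (v := v) (e := .inl (v.1.castSucc, v.2))
      (g := .inr (v.1, v.2.castSucc)) (by simp [incident]) (by simp [incident]) (by simp)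
      (by simp only [activeFace, Fin.val_castSucc, Prod.mk.injEq]; omega)
    have h2 := gyrate_corner (ε := ε) φ (v := v) (e := .inl (v.1.succ, v.2))
      (g := .inr (v.1, v.2.succ)) (by simp [incident]) (by simp [incident]) (by simp)
      (by simp only [activeFace, Fin.val_succ]; simp only [Prod.mk.injEq]; omega)
    revert h h1 h2
    generalize φ (.inl (v.1.castSucc, v.2)) = a
    generalize φ (.inl (v.1.succ, v.2)) = b
    generalize φ (.inr (v.1, v.2.castSucc)) = c
    generalize φ (.inr (v.1, v.2.succ)) = d
    rintro h (⟨h1, h2⟩ | ⟨h1, h2, h5⟩) (⟨h3, h4⟩ | ⟨h3, h4, h6⟩) <;> rw [h1, h2, h3, h4] <;>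
      clear h1 h2 h3 h4 <;> revert a b c d <;> decide
  · have h1 := gyrate_corner (ε := ε) φ (v := v) (e := .inl (v.1.castSucc, v.2))
      (g := .inr (v.1, v.2.succ)) (by simp [incident]) (by simp [incident]) (by simp)
      (by simp only [activeFace, Fin.val_succ, Fin.val_castSucc]; simp only [Prod.mk.injEq]; omega)
    have h2 := gyrate_corner (ε := ε) φ (v := v) (e := .inl (v.1.succ, v.2))
      (g := .inr (v.1, v.2.castSucc)) (by simp [incident]) (by simp [incident]) (by simp)
      (by simp only [activeFace, Fin.val_succ, Fin.val_castSucc]; simp only [Prod.mk.injEq]; omega)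
    revert h h1 h2
    generalize φ (.inl (v.1.castSucc, v.2)) = a
    generalize φ (.inl (v.1.succ, v.2)) = b
    generalize φ (.inr (v.1, v.2.castSucc)) = c
    generalize φ (.inr (v.1, v.2.succ)) = d
    rintro h (⟨h1, h2⟩ | ⟨h1, h2, h5⟩) (⟨h3, h4⟩ | ⟨h3, h4, h6⟩) <;> rw [h1, h2, h3, h4] <;>
      clear h1 h2 h3 h4 <;> revert a b c d <;> decide

/-- The faces on either side of a leg are boundary faces. -/
theorem activeFace_leg {n : ℕ} {ε : ℕ} (p : Fin (4 * n)) :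
    (activeFace ε (leg p)).1 = 0 ∨ (activeFace ε (leg p)).1 = n ∨
    (activeFace ε (leg p)).2 = 0 ∨ (activeFace ε (leg p)).2 = n := by
  unfold leg
  split_ifs <;> simp [activeFace]

theorem faceSign_leg {n : ℕ} {ε : ℕ} (φ : Colouring n) (p : Fin (4 * n)) :
    faceSign φ (activeFace ε (leg p)) = 0 := by
  have := activeFace_leg (ε := ε) p
  unfold faceSign
  rw [dif_neg (by omega)]

/-- Active boundary faces group the legs into cyclically consecutive pairs, including around the
four corners; `ε` selects one of the two such groupings. -/
theorem activeFace_leg_eq {n : ℕ} {ε : ℕ} (p q : Fin (4 * n)) (hp : (p.1 + ε) % 2 = 1)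
    (hpq : p.1 + 1 = 4 * n ∧ q.1 = 0 ∨ q.1 = p.1 + 1) :
    activeFace ε (leg p) = activeFace ε (leg q) := by
  have := p.2
  have := q.2
  unfold leg
  split_ifs <;>
    simp only [activeFace, Fin.val_last, Fin.val_zero, Prod.mk.injEq, true_and, and_true] <;> omega

theorem HasBdry.gyrate {n : ℕ} (ε : ℕ) {s : Bdry} {φ : Colouring n} (hφ : HasBdry s φ) :
    HasBdry s.flip (gyrate ε φ) := by
  intro p
  have h := hφ p
  rw [FPL.gyrate, faceSign_leg, if_pos rfl]
  cases s <;> simp only [Bdry.offset, Bdry.flip, Bool.not_eq_true'] at h ⊢ <;>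
    rw [← Bool.not_eq_true, h] <;> omega

/-- The half-gyration on fully-packed loops. -/
def gyration {n : ℕ} {ε : ℕ} (hε : ε < 2) {s : Bdry} (φ : Fpl n s) : Fpl n s.flip :=
  ⟨gyrate ε φ.1, φ.2.1.gyrate hε, φ.2.2.gyrate ε⟩

/-! ### Half-gyrations and black paths -/

theorem exists_corner_partner {n : ℕ} (ε : ℕ) {v : Vertex n} {e : Edge n}
    (hev : e ∈ incident v) :
    ∃ g ∈ incident v, g ≠ e ∧ activeFace ε g = activeFace ε e := by
  obtain ⟨x, y⟩ := v
  have aux : activeFace ε (.inl (x.castSucc, y) : Edge n) = activeFace ε (.inr (x, y.castSucc)) ∧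
      activeFace ε (.inl (x.succ, y) : Edge n) = activeFace ε (.inr (x, y.succ)) ∨
      activeFace ε (.inl (x.castSucc, y) : Edge n) = activeFace ε (.inr (x, y.succ)) ∧
      activeFace ε (.inl (x.succ, y) : Edge n) = activeFace ε (.inr (x, y.castSucc)) := by
    simp only [activeFace, Fin.val_succ, Fin.val_castSucc, Prod.mk.injEq]
    omega
  simp only [incident, Finset.mem_insert, Finset.mem_singleton] at hev ⊢
  rcases aux with ⟨h1, h2⟩ | ⟨h1, h2⟩ <;> rcases hev with rfl | rfl | rfl | rfl
  · exact ⟨.inr (x, y.castSucc), by simp, by simp, h1.symm⟩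
  · exact ⟨.inr (x, y.succ), by simp, by simp, h2.symm⟩
  · exact ⟨.inl (x.castSucc, y), by simp, by simp, h1⟩
  · exact ⟨.inl (x.succ, y), by simp, by simp, h2⟩
  · exact ⟨.inr (x, y.succ), by simp, by simp, h1.symm⟩
  · exact ⟨.inr (x, y.castSucc), by simp, by simp, h2.symm⟩
  · exact ⟨.inl (x.succ, y), by simp, by simp, h2⟩
  · exact ⟨.inl (x.castSucc, y), by simp, by simp, h1⟩

theorem IceRule.white {n : ℕ} {φ : Colouring n} (hφ : IceRule φ) {v : Vertex n} {e f g : Edge n}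
    (he : e ∈ incident v) (hf : f ∈ incident v) (hg : g ∈ incident v) (hef : e ≠ f) (hge : g ≠ e)
    (hgf : g ≠ f) (he' : φ e = true) (hf' : φ f = true) : φ g = false := by
  by_contra h
  rw [Bool.not_eq_false] at h
  have h3 : ({g, e, f} : Finset (Edge n)).card = 3 := by
    rw [Finset.card_eq_three]
    exact ⟨g, e, f, hge, hgf, hef, rfl⟩
  have hle := Finset.card_le_card (s := {g, e, f})
    (t := (incident v).filter fun e => φ e = true) (by
      intro a ha
      simp only [Finset.mem_insert, Finset.mem_singleton] at ha
      rcases ha with rfl | rfl | rfl <;> simp [*])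
  rw [h3, (hφ v).1] at hle
  omega

/-- Perpendicular sides of a face share a vertex. -/
theorem exists_common_vertex {n : ℕ} {ε : ℕ} {x : Fin (n + 1)} {y : Fin n} {x' : Fin n}
    {y' : Fin (n + 1)} (h : activeFace ε (.inl (x, y) : Edge n) = activeFace ε (.inr (x', y'))) :
    ∃ v : Vertex n, .inl (x, y) ∈ incident v ∧ .inr (x', y') ∈ incident v := by
  refine ⟨(x', y), ?_⟩
  simp only [activeFace, Prod.mk.injEq] at h
  simp only [incident, Finset.mem_insert, Finset.mem_singleton, Sum.inl.injEq, Sum.inr.injEq,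
    reduceCtorEq, Prod.mk.injEq, Fin.ext_iff, Fin.val_succ, Fin.val_castSucc, true_and, and_true,
    false_or, or_false]
  rcases Nat.mod_two_eq_zero_or_one (x.1 + y.1 + ε) with h1 | h1 <;>
    rcases Nat.mod_two_eq_zero_or_one (x'.1 + y'.1 + ε) with h2 | h2 <;>
    rw [h1, h2] at h <;> omega

theorem reachable_of_common_vertex {n : ℕ} {φ : Colouring n} {e f : Edge n} (he : φ e = true)
    (hf : φ f = true) (h : ∃ v : Vertex n, e ∈ incident v ∧ f ∈ incident v) :
    (blackGraph φ).Reachable e f := by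
  by_cases hef : e = f
  · rw [hef]
  · exact SimpleGraph.Adj.reachable ⟨hef, he, hf, h⟩

/-- Used to exclude boundary faces with two parallel black legs. -/
theorem HasBdry.not_consecutive {n : ℕ} {s : Bdry} {φ : Colouring n} (hφ : HasBdry s φ)
    {p q : Fin (4 * n)} (hp : φ (leg p) = true) (hq : φ (leg q) = true) (h : q.1 = p.1 + 1) :
    False := by
  rw [hφ p] at hp
  rw [hφ q] at hq
  omega

/-- In an interior face, sign `0` forces a third black side, which meets both horizontal ones. In a
boundary face the two sides would be consecutive legs, which are not both black. -/
theorem reachable_bottom_top {n : ℕ} {ε : ℕ} {s : Bdry} {φ : Colouring n}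
    (hφ : HasBdry s φ) {x : Fin (n + 1)} {y z : Fin n} (hyz : z.1 = y.1 + 1)
    (h : activeFace ε (.inl (x, y) : Edge n) = activeFace ε (.inl (x, z)))
    (h0 : faceSign φ (activeFace ε (.inl (x, y) : Edge n)) = 0) (hy : φ (.inl (x, y)) = true)
    (hz : φ (.inl (x, z)) = true) : (blackGraph φ).Reachable (.inl (x, y)) (.inl (x, z)) := by
  obtain ⟨x, hx⟩ := x
  obtain ⟨y, hy'⟩ := y
  obtain ⟨z, hz'⟩ := z
  simp only at hyz
  subst hyz
  by_cases hx0 : x = 0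
  · exfalso
    -- The left side is numbered downwards, so the upper edge comes first.
    refine hφ.not_consecutive (p := ⟨4 * n - 1 - (y + 1), by omega⟩) (q := ⟨4 * n - 1 - y, by omega⟩)
      ?_ ?_ (by simp only; omega)
    · convert hz using 2
      unfold leg
      rw [dif_neg (by simp only; omega), dif_neg (by simp only; omega),
        dif_neg (by simp only; omega)]
      simp [Fin.ext_iff]
      omega
    · convert hy using 2
      unfold leg
      rw [dif_neg (by simp only; omega), dif_neg (by simp only; omega),
        dif_neg (by simp only; omega)]
      simp [Fin.ext_iff]
      omega
  by_cases hxn : x = n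
  · exfalso
    refine hφ.not_consecutive (p := ⟨n + y, by omega⟩) (q := ⟨n + (y + 1), by omega⟩)
      ?_ ?_ (by simp only; omega)
    · convert hy using 2
      unfold leg
      rw [dif_neg (by simp only; omega), dif_pos (by simp only; omega)]
      simp [Fin.ext_iff]
      omega
    · convert hz using 2
      unfold leg
      rw [dif_neg (by simp only; omega), dif_pos (by simp only; omega)]
      simp [Fin.ext_iff]
      omega
  have hp : (x + y + ε) % 2 = 1 := by
    simp only [activeFace, Prod.mk.injEq] at h
    omega
  have hf : activeFace ε (.inl (⟨x, hx⟩, ⟨y, hy'⟩) : Edge n) = (x, y + 1) := by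
    simp [activeFace, hp]
  rw [hf] at h h0
  obtain ⟨x, rfl⟩ := Nat.exists_eq_succ_of_ne_zero hx0
  let α : Plaquette n := (⟨x, by omega⟩, ⟨y, by omega⟩)
  rw [show (x.succ, y + 1) = (α.1.1 + 1, α.2.1 + 1) from rfl, faceSign_plaquette] at h0
  have hbot : α.bottom = .inl (⟨x.succ, hx⟩, ⟨y, hy'⟩) := rfl
  have htop : α.top = .inl (⟨x.succ, hx⟩, ⟨y + 1, hz'⟩) := rfl
  obtain ⟨hb, ht, hl, hr⟩ := activeFace_sides (α := α) (ε := ε) (show (x + y + ε) % 2 = 0 by omega)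
  rw [← hbot] at hy ⊢
  rw [← htop] at hz ⊢
  have hside : φ α.left = true ∨ φ α.right = true := by
    by_contra hcon
    push Not at hcon
    simp only [Bool.not_eq_true] at hcon
    unfold plaquetteSign at h0
    simp [hy, hz, hcon] at h0
  rcases hside with hs | hs
  · exact (reachable_of_common_vertex hy hs (exists_common_vertex (hb.trans hl.symm))).trans
      (reachable_of_common_vertex hz hs (exists_common_vertex (ht.trans hl.symm))).symm
  · exact (reachable_of_common_vertex hy hs (exists_common_vertex (hb.trans hr.symm))).trans
      (reachable_of_common_vertex hz hs (exists_common_vertex (ht.trans hr.symm))).symm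

/-- The same argument as `reachable_bottom_top`, with the two directions exchanged. -/
theorem reachable_left_right {n : ℕ} {ε : ℕ} {s : Bdry} {φ : Colouring n}
    (hφ : HasBdry s φ) {x z : Fin n} {y : Fin (n + 1)} (hxz : z.1 = x.1 + 1)
    (h : activeFace ε (.inr (x, y) : Edge n) = activeFace ε (.inr (z, y)))
    (h0 : faceSign φ (activeFace ε (.inr (x, y) : Edge n)) = 0) (hx : φ (.inr (x, y)) = true)
    (hz : φ (.inr (z, y)) = true) : (blackGraph φ).Reachable (.inr (x, y)) (.inr (z, y)) := by
  obtain ⟨x, hx'⟩ := x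
  obtain ⟨y, hy⟩ := y
  obtain ⟨z, hz'⟩ := z
  simp only at hxz
  subst hxz
  by_cases hy0 : y = 0
  · exfalso
    refine hφ.not_consecutive (p := ⟨x, by omega⟩) (q := ⟨x + 1, by omega⟩) ?_ ?_ rfl
    · convert hx using 2
      unfold leg
      rw [dif_pos (by simp only; omega)]
      simp [Fin.ext_iff]
      omega
    · convert hz using 2
      unfold leg
      rw [dif_pos (by simp only; omega)]
      simp [Fin.ext_iff]
      omega
  by_cases hyn : y = n
  · exfalso
    refine hφ.not_consecutive (p := ⟨3 * n - 1 - (x + 1), by omega⟩)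
      (q := ⟨3 * n - 1 - x, by omega⟩) ?_ ?_ (by simp only; omega)
    · convert hz using 2
      unfold leg
      rw [dif_neg (by simp only; omega), dif_neg (by simp only; omega),
        dif_pos (by simp only; omega)]
      simp [Fin.ext_iff]
      omega
    · convert hx using 2
      unfold leg
      rw [dif_neg (by simp only; omega), dif_neg (by simp only; omega),
        dif_pos (by simp only; omega)]
      simp [Fin.ext_iff]
      omega
  have hp : (x + y + ε) % 2 = 1 := by
    simp only [activeFace, Prod.mk.injEq] at h
    omega
  have hf : activeFace ε (.inr (⟨x, hx'⟩, ⟨y, hy⟩) : Edge n) = (x + 1, y) := by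
    simp [activeFace, hp]
  rw [hf] at h h0
  obtain ⟨y, rfl⟩ := Nat.exists_eq_succ_of_ne_zero hy0
  let α : Plaquette n := (⟨x, by omega⟩, ⟨y, by omega⟩)
  rw [show (x + 1, y.succ) = (α.1.1 + 1, α.2.1 + 1) from rfl, faceSign_plaquette] at h0
  have hleft : α.left = .inr (⟨x, hx'⟩, ⟨y.succ, hy⟩) := rfl
  have hright : α.right = .inr (⟨x + 1, hz'⟩, ⟨y.succ, hy⟩) := rfl
  obtain ⟨hb, ht, hl, hr⟩ := activeFace_sides (α := α) (ε := ε) (show (x + y + ε) % 2 = 0 by omega)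
  rw [← hleft] at hx ⊢
  rw [← hright] at hz ⊢
  have hside : φ α.bottom = true ∨ φ α.top = true := by
    by_contra hcon
    push Not at hcon
    simp only [Bool.not_eq_true] at hcon
    unfold plaquetteSign at h0
    simp [hx, hz, hcon] at h0
  rcases hside with hs | hs
  · exact (reachable_of_common_vertex hs hx (exists_common_vertex (hb.trans hl.symm))).symm.trans
      (reachable_of_common_vertex hs hz (exists_common_vertex (hb.trans hr.symm)))
  · exact (reachable_of_common_vertex hs hx (exists_common_vertex (ht.trans hl.symm))).symm.trans
      (reachable_of_common_vertex hs hz (exists_common_vertex (ht.trans hr.symm)))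

/-- The black sides of a face that is not alternating are on the same black path. -/
theorem reachable_of_activeFace_eq {n : ℕ} {ε : ℕ} {s : Bdry} {φ : Colouring n}
    (hφ : HasBdry s φ) {e g : Edge n} (h : activeFace ε e = activeFace ε g)
    (h0 : faceSign φ (activeFace ε e) = 0) (he : φ e = true) (hg : φ g = true) :
    (blackGraph φ).Reachable e g := by
  rcases e with ⟨x, y⟩ | ⟨x, y⟩ <;> rcases g with ⟨x', y'⟩ | ⟨x', y'⟩
  · have hx : x = x' := by
      simp only [activeFace, Prod.mk.injEq] at h
      omega
    subst hx
    have hy : y'.1 = y.1 ∨ y'.1 = y.1 + 1 ∨ y.1 = y'.1 + 1 := by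
      simp only [activeFace, Prod.mk.injEq] at h
      omega
    rcases hy with hy | hy | hy
    · rw [Fin.ext hy]
    · exact reachable_bottom_top hφ hy h h0 he hg
    · exact (reachable_bottom_top hφ hy h.symm (h ▸ h0) hg he).symm
  · exact reachable_of_common_vertex he hg (exists_common_vertex h)
  · exact (reachable_of_common_vertex hg he (exists_common_vertex h.symm)).symm
  · have hy : y = y' := by
      simp only [activeFace, Prod.mk.injEq] at h
      omega
    subst hy
    have hx : x'.1 = x.1 ∨ x'.1 = x.1 + 1 ∨ x.1 = x'.1 + 1 := by
      simp only [activeFace, Prod.mk.injEq] at h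
      omega
    rcases hx with hx | hx | hx
    · rw [Fin.ext hx]
    · exact reachable_left_right hφ hx h h0 he hg
    · exact (reachable_left_right hφ hx h.symm (h ▸ h0) hg he).symm

/-- A half-gyration preserves the connectivity of the active boundary faces by black paths. -/
theorem reachable_gyrate {n : ℕ} {ε : ℕ} (hε : ε < 2) {s : Bdry} (φ : Fpl n s) {a b a' b' : Edge n}
    (ha0 : faceSign φ.1 (activeFace ε a) = 0) (hb0 : faceSign φ.1 (activeFace ε b) = 0)
    (haa : activeFace ε a' = activeFace ε a) (hbb : activeFace ε b' = activeFace ε b)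
    (ha' : gyrate ε φ.1 a' = true) (hb' : gyrate ε φ.1 b' = true)
    (h : (blackGraph φ.1).Reachable a b) : (blackGraph (gyrate ε φ.1)).Reachable a' b' := by
  -- Invariant carried along the old path: the new path from `a'` has reached the active face of
  -- `e`. If that face is alternating it must have reached `e` itself, since nothing inside the face
  -- joins its two black sides.
  let Q : Edge n → Prop := fun e =>
    ∃ e', activeFace ε e' = activeFace ε e ∧ (faceSign φ.1 (activeFace ε e) ≠ 0 → e' = e) ∧
      (blackGraph (gyrate ε φ.1)).Reachable a' e'
  -- A face of sign `0` still has sign `0` after the half-gyration, so its new black sides lie on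
  -- one path; in an alternating face there is nothing to move.
  have hmove : ∀ {e e₁ : Edge n}, Q e → activeFace ε e₁ = activeFace ε e →
      (faceSign φ.1 (activeFace ε e) ≠ 0 → e₁ = e) → gyrate ε φ.1 e₁ = true →
      (blackGraph (gyrate ε φ.1)).Reachable a' e₁ := by
    rintro e e₁ ⟨e', h1, h2, h3⟩ h4 h5 h6
    by_cases h0 : faceSign φ.1 (activeFace ε e) = 0
    · refine h3.trans (reachable_of_activeFace_eq (φ.2.2.gyrate ε) (h1.trans h4.symm) ?_
        (black_of_reachable ha' h3) h6)
      rw [faceSign_gyrate_activeFace hε, h1, h0]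
    · rw [h5 h0, ← h2 h0]
      exact h3
  have hstep : ∀ e f, Q e → (blackGraph φ.1).Adj e f → Q f := by
    rintro e f hQ ⟨hef, he, hf, v, hev, hfv⟩
    by_cases hface : activeFace ε e = activeFace ε f
    -- Perpendicular sides of an alternating face have opposite colours, so two black ones exclude
    -- it.
    · have h0 : faceSign φ.1 (activeFace ε f) = 0 := by
        by_contra h0
        have h1 := faceSign_colour h0
        have h2 := faceSign_colour (e := e) (ε := ε) (φ := φ.1) (hface ▸ h0)
        have h3 := isLeft_ne hev hfv hef hface
        rw [hface, h1, he, hf, h3] at h2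
        cases hh : f.isLeft <;> simp [hh] at h2
      obtain ⟨e', h1, -, h3⟩ := hQ
      exact ⟨e', h1.trans hface, fun h => absurd h0 h, h3⟩
    -- Here `e` and `f` lie in different corners at `v`, and each corner still has a black edge at
    -- `v`: the old one if kept, otherwise its partner, which was white because `e` and `f` are the
    -- only black edges there.
    · have hstar : ∀ e f, e ≠ f → activeFace ε e ≠ activeFace ε f → φ.1 e = true →
          φ.1 f = true → e ∈ incident v → f ∈ incident v →
          ∃ e₁ ∈ incident v, activeFace ε e₁ = activeFace ε e ∧
            (faceSign φ.1 (activeFace ε e) ≠ 0 → e₁ = e) ∧ gyrate ε φ.1 e₁ = true := by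
        intro e f hef hface he hf hev hfv
        by_cases h0 : faceSign φ.1 (activeFace ε e) = 0
        · obtain ⟨g, hgv, hge, hg⟩ := exists_corner_partner ε hev
          have hgf : g ≠ f := by
            rintro rfl
            exact hface hg.symm
          have hgw := φ.2.1.white hev hfv hgv hef hge hgf he hf
          exact ⟨g, hgv, hg, fun h => absurd h0 h, by simp [gyrate, hg, h0, hgw]⟩
        · exact ⟨e, hev, rfl, fun _ => rfl, by simp [gyrate, h0, he]⟩
      obtain ⟨e₁, he₁v, he₁, he₁0, he₁b⟩ := hstar e f hef hface he hf hev hfv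
      obtain ⟨f₁, hf₁v, hf₁, hf₁0, hf₁b⟩ := hstar f e hef.symm (Ne.symm hface) hf he hfv hev
      exact ⟨f₁, hf₁, hf₁0, (hmove hQ he₁ he₁0 he₁b).trans
        (reachable_of_common_vertex he₁b hf₁b ⟨v, he₁v, hf₁v⟩)⟩
  have hQa : Q a := ⟨a', haa, fun h => absurd ha0 h, SimpleGraph.Reachable.refl _⟩
  have hwalk : ∀ {e f}, (blackGraph φ.1).Walk e f → Q e → Q f := by
    intro e f w
    induction w with
    | nil => exact id
    | cons h _ ih => exact fun hQ => ih (hstep _ _ hQ h)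
  obtain ⟨w⟩ := h
  exact hmove (hwalk w hQa) hbb (fun h => absurd hb0 h) hb'

/-! ### Effect of a half-gyration on the link pattern. -/

theorem linkPattern_mate_eq {n : ℕ} {s : Bdry} (φ : Fpl n s) {k l : Fin (2 * n)} (hkl : l ≠ k)
    (h : (blackGraph φ.1).Reachable (blackLeg s k) (blackLeg s l)) :
    (linkPattern φ).mate k = l :=
  (existsUnique_mate φ k).unique (existsUnique_mate φ k).choose_spec.1 ⟨hkl, h⟩

theorem reachable_mate {n : ℕ} {s : Bdry} (φ : Fpl n s) (k : Fin (2 * n)) :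
    (blackGraph φ.1).Reachable (blackLeg s k) (blackLeg s ((linkPattern φ).mate k)) :=
  (existsUnique_mate φ k).choose_spec.1.2

/-- The relabelling `r` matches each new black leg with the old one on the same active boundary
face; `reachable_gyrate` then transports the pairing. -/
theorem linkPattern_gyration_mate {n : ℕ} {ε : ℕ} (hε : ε < 2) {s : Bdry} (φ : Fpl n s)
    (r : Equiv.Perm (Fin (2 * n)))
    (hr : ∀ k, activeFace ε (blackLeg s.flip k) = activeFace ε (blackLeg s (r k)))
    (k : Fin (2 * n)) :
    (linkPattern (gyration hε φ)).mate k = r.symm ((linkPattern φ).mate (r k)) := by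
  apply linkPattern_mate_eq
  · intro h
    rw [Equiv.symm_apply_eq] at h
    exact (linkPattern φ).mate_ne _ h
  · refine reachable_gyrate hε φ (faceSign_leg _ _) (faceSign_leg _ _) (hr k) ?_
      (blackLeg_black (gyration hε φ) _)
      (blackLeg_black (gyration hε φ) _) (reachable_mate φ (r k))
    rw [hr, Equiv.apply_symm_apply]
    rfl

theorem rotationClass_rotate {n : ℕ} (π : LinkPattern n) :
    rotationClass (rotate π) = rotationClass π :=
  Quotient.sound (Equiv.Perm.SameCycle.symm ⟨1, by simp [rotation]⟩)

theorem rotationClass_gyration_plus {n : ℕ} {ε : ℕ} (hε : ε < 2) (φ : Fpl n .plus) :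
    rotationClass (linkPattern (gyration hε φ)) = rotationClass (linkPattern φ) := by
  obtain rfl | rfl : ε = 0 ∨ ε = 1 := by omega
  -- For `ε = 0` the new black leg at position `2k + 1` shares a face with the old one at `2k + 2`,
  -- cyclically: label `k` corresponds to `k + 1`, which is the rotation `R`.
  · rw [← rotationClass_rotate (linkPattern φ)]
    congr 1
    apply LinkPattern.ext
    funext k
    refine linkPattern_gyration_mate hε φ (finRotate (2 * n)) (fun k => ?_) k
    have h := finRotate_val k
    have := k.2
    refine activeFace_leg_eq _ _ ?_ ?_ <;> simp only [Bdry.flip, Bdry.offset]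
    · omega
    · split_ifs at h <;> omega
  -- For `ε = 1` the positions `2k` and `2k + 1` share a face, so labels do not move.
  · congr 1
    apply LinkPattern.ext
    funext k
    refine linkPattern_gyration_mate hε φ (Equiv.refl _) (fun k => ?_) k
    refine (activeFace_leg_eq _ _ ?_ (Or.inr rfl)).symm
    simp only [Bdry.offset, Equiv.refl_apply]
    omega

/-- The half-gyration as a bijection from `Fpl(n, +)` to `Fpl(n, -)`. -/
def gyrationEquiv (n : ℕ) {ε : ℕ} (hε : ε < 2) : Fpl n .plus ≃ Fpl n .minus where
  toFun φ := gyration hε φ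
  invFun φ := gyration hε φ
  left_inv φ := Subtype.ext (gyrate_gyrate hε φ.1)
  right_inv φ := Subtype.ext (gyrate_gyrate hε φ.1)

theorem sum_fplClass_minus {n : ℕ} {ε : ℕ} (hε : ε < 2) (c : RotationClass n)
    (F : Colouring n → ℤ) :
    ∑ φ ∈ fplClass .minus c, F φ.1 = ∑ φ ∈ fplClass .plus c, F (gyrate ε φ.1) := by
  symm
  refine Finset.sum_equiv (gyrationEquiv n hε) (fun φ => ?_) (fun φ _ => rfl)
  simp only [fplClass, Finset.mem_filter, Finset.mem_univ, true_and]
  rw [← rotationClass_gyration_plus hε φ]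
  rfl

/-! ### The sum over a rotation class -/

/-- `+1` for black and `-1` for white. -/
def colourSign (b : Bool) : ℤ := if b then 1 else -1

/-- A complemented edge contributes zero. A kept edge counts twice, and a vertical edge of an
alternating face is black exactly when the sign is `-1`. -/
theorem colourSign_gyrate {n : ℕ} (ε : ℕ) (φ : Colouring n) (v : Fin n × Fin (n + 1)) :
    colourSign (φ (.inr v)) + colourSign (gyrate ε φ (.inr v)) =
      -2 * faceSign φ (activeFace ε (.inr v : Edge n)) := by
  unfold gyrate
  by_cases h0 : faceSign φ (activeFace ε (.inr v : Edge n)) = 0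
  · rw [if_pos h0, h0]
    cases φ (.inr v) <;> simp [colourSign]
  · rw [if_neg h0, faceSign_colour h0]
    cases φ (.inr v) <;> simp [colourSign]

/-- Both sides are `-1/2` times the same total of the colours of `v` over the class, taken over both
boundary conditions; only the bijection used depends on the parity. -/
theorem sum_faceSign_activeFace {n : ℕ} {ε ε' : ℕ} (hε : ε < 2) (hε' : ε' < 2)
    (c : RotationClass n) (v : Fin n × Fin (n + 1)) :
    ∑ φ ∈ fplClass .plus c, faceSign φ.1 (activeFace ε (.inr v : Edge n)) =
      ∑ φ ∈ fplClass .plus c, faceSign φ.1 (activeFace ε' (.inr v : Edge n)) := by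
  have key : ∀ {ε}, ε < 2 → ∑ φ ∈ fplClass .plus c, colourSign (φ.1 (.inr v)) +
      ∑ φ ∈ fplClass .minus c, colourSign (φ.1 (.inr v)) =
      -2 * ∑ φ ∈ fplClass .plus c, faceSign φ.1 (activeFace ε (.inr v : Edge n)) := by
    intro ε hε
    rw [sum_fplClass_minus hε c fun φ => colourSign (φ (.inr v)), ← Finset.sum_add_distrib,
      Finset.mul_sum]
    exact Finset.sum_congr rfl fun φ _ => colourSign_gyrate ε φ.1 v
  have h1 := key hε
  have h2 := key hε'
  omega

theorem sum_faceSign_plus {n : ℕ} (c : RotationClass n) (x y : ℕ) (hx : x ≤ n) (hy : y ≤ n) :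
    ∑ φ ∈ fplClass .plus c, faceSign φ.1 (x, y) = 0 := by
  induction x with
  | zero => exact Finset.sum_eq_zero fun φ _ => by simp [faceSign]
  | succ x ih =>
    rw [← ih (by omega)]
    -- The vertical edge `(x, y)` separates the faces `(x, y)` and `(x + 1, y)`; these parities
    -- select them in this order.
    have h := sum_faceSign_activeFace (ε := (x + y) % 2) (ε' := (x + y + 1) % 2) (by omega)
      (by omega) c (⟨x, by omega⟩, ⟨y, by omega⟩)
    have aux : ∀ ε, activeFace ε (.inr (⟨x, by omega⟩, ⟨y, by omega⟩) : Edge n) =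
        (x + (x + y + ε) % 2, y) := fun _ => rfl
    rw [aux, aux, show (x + y + (x + y) % 2) % 2 = 0 by omega,
      show (x + y + (x + y + 1) % 2) % 2 = 1 by omega] at h
    exact h.symm

theorem sum_plaquetteSign {n : ℕ} (s : Bdry) (α : Plaquette n) (c : RotationClass n) :
    ∑ φ ∈ fplClass s c, plaquetteSign α φ.1 = 0 := by
  simp only [← faceSign_plaquette]
  have h1 := α.1.2
  have h2 := α.2.2
  have hplus := sum_faceSign_plus c (α.1.1 + 1) (α.2.1 + 1) (by omega) (by omega)
  cases s with
  | plus => exact hplus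
  | minus =>
    -- The parity is that of the face of `α`, so that its sign survives the half-gyration.
    rw [sum_fplClass_minus (ε := (α.1.1 + 1 + (α.2.1 + 1)) % 2) (by omega) c
      fun φ => faceSign φ (α.1.1 + 1, α.2.1 + 1), ← hplus]
    exact Finset.sum_congr rfl fun φ _ => faceSign_gyrate φ.1

/-! ### The vector form -/

theorem finRotate_pow_val {m : ℕ} (k : ℕ) (i : Fin m) :
    ((finRotate m ^ k) i).1 = (i.1 + k) % m := by
  induction k with
  | zero => exact (Nat.mod_eq_of_lt i.2).symm
  | succ k ih =>
    have h := ((finRotate m ^ k) i).2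
    rw [pow_succ', Equiv.Perm.mul_apply, finRotate_val, ← add_assoc, ← Nat.mod_add_mod, ← ih]
    split_ifs with h'
    · rw [h', Nat.mod_self]
    · rw [Nat.mod_eq_of_lt (by omega)]

theorem finRotate_pow_eq_one (m : ℕ) : finRotate m ^ m = 1 := by
  ext i
  rw [finRotate_pow_val, Nat.add_mod_right, Nat.mod_eq_of_lt i.2, Equiv.Perm.one_apply]

theorem rotation_pow_mate {n : ℕ} (k : ℕ) (π : LinkPattern n) (i : Fin (2 * n)) :
    ((rotation n ^ k) π).mate i =
      (finRotate (2 * n) ^ k).symm (π.mate ((finRotate (2 * n) ^ k) i)) := by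
  induction k generalizing π with
  | zero => rfl
  | succ k ih =>
    rw [pow_succ, Equiv.Perm.mul_apply, ih, pow_succ' (finRotate (2 * n))]
    rfl

theorem rotation_pow_eq_one (n : ℕ) : rotation n ^ (2 * n) = 1 := by
  ext π : 1
  apply LinkPattern.ext
  funext i
  rw [rotation_pow_mate, finRotate_pow_eq_one]
  rfl

theorem rotOp_pow_single {n : ℕ} (k : ℕ) (π : LinkPattern n) :
    (rotOp n ^ k) (Finsupp.single π 1) = Finsupp.single ((rotation n ^ k) π) 1 := by
  induction k with
  | zero => simp
  | succ k ih =>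
    rw [pow_succ', Module.End.mul_apply, ih, pow_succ', Equiv.Perm.mul_apply, rotOp,
      Finsupp.lmapDomain_apply, Finsupp.mapDomain_single]

theorem symOp_single {n : ℕ} (π : LinkPattern n) :
    symOp n (Finsupp.single π 1) =
      ∑ k ∈ Finset.range (2 * n), Finsupp.single ((rotation n ^ k) π) (1 : ℂ) := by
  rw [symOp, LinearMap.sum_apply]
  exact Finset.sum_congr rfl fun k _ => rotOp_pow_single k π

/-- Since `R ^ (2 n) = 1`, the sums over `k = 1, …, 2 n` and `k = 0, …, 2 n - 1` agree: split the
sum of `2 n + 1` terms at either end and cancel. -/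
theorem symOp_single_rotation {n : ℕ} (π : LinkPattern n) :
    symOp n (Finsupp.single (rotation n π) 1) = symOp n (Finsupp.single π 1) := by
  rw [symOp_single, symOp_single]
  have h1 := Finset.sum_range_succ
    (fun k => Finsupp.single ((rotation n ^ k) π) (1 : ℂ)) (2 * n)
  rw [Finset.sum_range_succ', rotation_pow_eq_one, pow_zero] at h1
  simpa only [pow_succ, Equiv.Perm.mul_apply] using add_right_cancel h1

theorem symOp_single_eq {n : ℕ} {π π' : LinkPattern n}
    (h : rotationClass π = rotationClass π') :
    symOp n (Finsupp.single π 1) = symOp n (Finsupp.single π' 1) := by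
  obtain ⟨k, hk⟩ : (rotation n).SameCycle π π' := Quotient.exact h
  rw [← hk]
  clear hk h
  induction k with
  | zero => simp
  | succ k ih => rw [add_comm, zpow_add, zpow_one, Equiv.Perm.mul_apply, symOp_single_rotation, ih]
  | pred k ih =>
    rw [ih, ← symOp_single_rotation ((rotation n ^ (-(k : ℤ) - 1)) π), ← Equiv.Perm.mul_apply,
      ← zpow_one_add]
    congr 4
    ring

theorem symOp_apply_allFpl (n : ℕ) (s : Bdry) (α : Plaquette n) :
    symOp n (projOp n s (signOp s α (allFpl n s))) =
      ∑ φ : Fpl n s, (plaquetteSign α φ.1 : ℂ) • symOp n (Finsupp.single (linkPattern φ) 1) := by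
  rw [allFpl, map_sum, map_sum, map_sum]
  refine Finset.sum_congr rfl fun φ _ => ?_
  rw [signOp, Finsupp.lsum_single, LinearMap.smul_apply, Finsupp.lsingle_apply, map_smul, map_smul,
    projOp, Finsupp.lmapDomain_apply, Finsupp.mapDomain_single]

theorem symOp_projOp_signOp_allFpl (n : ℕ) (s : Bdry) (α : Plaquette n) :
    symOp n (projOp n s (signOp s α (allFpl n s))) = 0 := by
  classical
  -- Group by rotation class: on each one the symmetrised vector is constant and factors out of a
  -- vanishing sum of signs.
  rw [symOp_apply_allFpl, ← Finset.sum_fiberwise_of_maps_to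
    (g := fun φ : Fpl n s => rotationClass (linkPattern φ))
    (t := Finset.univ.image fun φ : Fpl n s => rotationClass (linkPattern φ))
    (fun φ _ => Finset.mem_image_of_mem _ (Finset.mem_univ φ))]
  refine Finset.sum_eq_zero fun c hc => ?_
  obtain ⟨φ₀, -, rfl⟩ := Finset.mem_image.1 hc
  have h := sum_plaquetteSign s α (rotationClass (linkPattern φ₀))
  rw [fplClass] at h
  rw [Finset.sum_congr rfl (g := fun φ : Fpl n s =>
    (plaquetteSign α φ.1 : ℂ) • symOp n (Finsupp.single (linkPattern φ₀) 1)) (fun φ hφ => by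
      rw [symOp_single_eq (Finset.mem_filter.1 hφ).2]), ← Finset.sum_smul, ← Int.cast_sum]
  convert zero_smul ℂ _
  rw [Int.cast_eq_zero]
  convert h

end FPL

theorem corollary1 (n : ℕ) (s : FPL.Bdry) (α : FPL.Plaquette n) :
    (∀ c : FPL.RotationClass n, ∑ φ ∈ FPL.fplClass s c, FPL.plaquetteSign α φ.1 = 0) ∧
    FPL.symOp n (FPL.projOp n s (FPL.signOp s α (FPL.allFpl n s))) = 0 := by
  exact ⟨FPL.sum_plaquetteSign s α, FPL.symOp_projOp_signOp_allFpl n s α⟩
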